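/- For $k\ge 0$ let $\pi_k:SU(2)\to\mathcal U(H_k)$, $H_k=\mathbb C^{k+1}$, be the irreducible unitary representation of $SU(2)$ of dimension $k+1$, realized as the $k$-th symmetric power of the defining representation with its canonical orthonormal (weight) basis $|0\rangle,\dots,|k\rangle$. Given an isometry $\alpha:H_k\to H_l\otimes H_m$ with $(\pi_l(x)\otimes\pi_m(x))\alpha=\alpha\,\pi_k(x)$ for all $x\in SU(2)$, let $\Phi^{k\to l}_m:B(H_k)\to B(H_l)$, $\Phi^{k\to l}_m(X)=(\mathrm{id}\otimes\mathrm{Tr})(\alpha X\alpha^*)$ (the $SU(2)$-Clebsch–Gordan channel). For a linear map $\Phi:B(H_A)\to B(H_B)$ with Choi matrix $C_\Phi=\sum_{i,j}|i\rangle\langle j|\otimes\Phi(|i\rangle\langle j|)$, say that $\Phi$ is PPT if $(\mathrm{id}\otimes T_B)(C_\Phi)\ge 0$, where $T_B$ is the transpose on $B(H_B)$, and that $\Phi$ is entanglement-breaking (EBT) if $\frac1{\dim H_A}C_\Phi=\sum_i p_i\,\rho_i^A\otimes\rho_i^B$ for some (finite) probability distribution $(p_i)$ and quantum states $\rho_i^A$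 on $H_A$ and $\rho_i^B$ on $H_B$. **Theorem.** Let $l\ge 1$ be an integer. The channels $\Phi^{1\to l}_{l-1}$ and $\Phi^{1\to l}_{l+1}$ exist and do not depend on the choice of $\alpha$. For $0\le p\le 1$ put $\Phi_p=(1-p)\,\Phi^{1\to l}_{l-1}+p\,\Phi^{1\to l}_{l+1}$. Then $$\Phi_p\text{ is PPT}\iff \frac1{l+1}\le p\le 1\iff \Phi_p\text{ is EBT}.$$ -/

import Mathlib

open scoped Kronecker ComplexOrder

namespace SU2Channel

/-- Operators on the Hilbert space `H_k = ℂ^(k+1)`, as matrices in its canonical orthonormal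
basis `|0⟩, …, |k⟩`. -/
abbrev Op (k : ℕ) : Type := Matrix (Fin (k + 1)) (Fin (k + 1)) ℂ

/-- The irreducible unitary representation `π_k` of `SU(2)` on `H_k`: the `k`-th symmetric power
of the defining representation. `H_k` is the space of homogeneous polynomials of degree `k` in
`u, v`, on which `x = !![a, b; c, d]` acts by the substitution `u ↦ a u + c v`, `v ↦ b u + d v`,
with canonical orthonormal basis `|i⟩ = √(k.choose i) u^(k-i) v^i`.
The `(j, i)` entry is the coefficient of `|j⟩` in the image of `|i⟩` (computed with `u = 1`). -/
noncomputable def rep (k : ℕ) (x : Matrix (Fin 2) (Fin 2) ℂ) : Op k :=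
  Matrix.of fun j i =>
    ((Real.sqrt ((k.choose i : ℝ) / (k.choose j : ℝ)) : ℝ) : ℂ) *
      ((Polynomial.C (x 0 0) + Polynomial.C (x 1 0) * Polynomial.X) ^ (k - (i : ℕ)) *
        (Polynomial.C (x 0 1) + Polynomial.C (x 1 1) * Polynomial.X) ^ (i : ℕ)).coeff j

/-- `α : H_k → H_l ⊗ H_m` is an isometry intertwining `π_k` with `π_l ⊗ π_m`. -/
def IsClebschGordanIsometry (k l m : ℕ)
    (α : Matrix (Fin (l + 1) × Fin (m + 1)) (Fin (k + 1)) ℂ) : Prop :=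
  α.conjTranspose * α = 1 ∧
    ∀ x ∈ Matrix.specialUnitaryGroup (Fin 2) ℂ, (rep l x ⊗ₖ rep m x) * α = α * rep k x

/-- The partial trace `id ⊗ Tr` over the second tensor factor. -/
def partialTraceRight {A B : Type*} [Fintype B] (M : Matrix (A × B) (A × B) ℂ) :
    Matrix A A ℂ :=
  Matrix.of fun a a' => ∑ b, M (a, b) (a', b)

/-- The linear map `X ↦ (id ⊗ Tr)(α X α*)` with Stinespring operator `α`. -/
def stinespring {k l m : ℕ} (α : Matrix (Fin (l + 1) × Fin (m + 1)) (Fin (k + 1)) ℂ) :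
    Op k →ₗ[ℂ] Op l where
  toFun X := partialTraceRight (α * X * α.conjTranspose)
  map_add' X Y := by
    ext a a'
    simp [partialTraceRight, Matrix.mul_add, Matrix.add_mul, Finset.sum_add_distrib]
  map_smul' c X := by
    ext a a'
    simp [partialTraceRight, Finset.mul_sum]

/-- `Φ` is the Clebsch-Gordan channel `Φ^{k→l}_m : B(H_k) → B(H_l)`, i.e. the channel whose
Stinespring isometry is an isometric intertwiner `H_k → H_l ⊗ H_m`. -/
def IsClebschGordanChannel (k l m : ℕ) (Φ : Op k →ₗ[ℂ] Op l) : Prop :=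
  ∃ α, IsClebschGordanIsometry k l m α ∧ Φ = stinespring α

/-- The Choi matrix `C_Φ = ∑ i j, |i⟩⟨j| ⊗ Φ(|i⟩⟨j|)`. -/
def choi {k l : ℕ} (Φ : Op k →ₗ[ℂ] Op l) :
    Matrix (Fin (k + 1) × Fin (l + 1)) (Fin (k + 1) × Fin (l + 1)) ℂ :=
  ∑ i, ∑ j, Matrix.single i j (1 : ℂ) ⊗ₖ Φ (Matrix.single i j (1 : ℂ))

/-- The partial transpose `id ⊗ T` on the second tensor factor. -/
def partialTranspose {A B : Type*} (M : Matrix (A × B) (A × B) ℂ) :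
    Matrix (A × B) (A × B) ℂ :=
  Matrix.of fun s t => M (s.1, t.2) (t.1, s.2)

/-- Positive partial transpose: `(id ⊗ T)(C_Φ) ≥ 0`. -/
def IsPPT {k l : ℕ} (Φ : Op k →ₗ[ℂ] Op l) : Prop :=
  (partialTranspose (choi Φ)).PosSemidef

/-- Quantum states: positive semidefinite matrices of trace one. -/
def IsState {A : Type*} [Fintype A] (ρ : Matrix A A ℂ) : Prop :=
  ρ.PosSemidef ∧ ρ.trace = 1

/-- Separable states: finite convex combinations of product states. -/
def IsSeparable {A B : Type*} [Fintype A] [Fintype B] (M : Matrix (A × B) (A × B) ℂ) : Prop :=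
  ∃ (n : ℕ) (w : Fin n → ℝ) (ρ : Fin n → Matrix A A ℂ) (σ : Fin n → Matrix B B ℂ),
    (∀ i, 0 ≤ w i) ∧ ∑ i, w i = 1 ∧ (∀ i, IsState (ρ i)) ∧ (∀ i, IsState (σ i)) ∧
      M = ∑ i, (w i : ℂ) • (ρ i ⊗ₖ σ i)

/-- Entanglement breaking: the normalized Choi matrix `C_Φ / d_A`, where `d_A = dim H_k = k + 1`,
is separable. -/
def IsEBT {k l : ℕ} (Φ : Op k →ₗ[ℂ] Op l) : Prop :=
  IsSeparable ((1 / ((k : ℂ) + 1)) • choi Φ)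

end SU2Channel

/-!
A channel `Φ : B(H_1) → B(H_l)` is governed by its Choi matrix, and covariance under `SU(2)` makes
all Choi matrices in question explicit: in the weight basis they split into blocks of size at most
two, one for each value of `i - a` at the basis vector `|a⟩ ⊗ |i⟩`.

*Existence and uniqueness of the channels.* Up to normalisation, the intertwiner
`H_1 → H_d ⊗ H_{d+1}` multiplies by the invariant `(Y - X)^d`; equivariance is the identity
`P(X) Q(Y) - Q(X) P(Y) = det x • (Y - X)` for the columns `P`, `Q` of `x` (`sum_coeff_det_pow`,
`isIntertwiner_cgIsometry`). The intertwiner `H_1 → H_{d+1} ⊗ H_d` is obtained by exchanging the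
tensor factors. Multiplicity one (`IsIntertwiner.eq_zero`) follows by differentiating the
intertwining relation along two one-parameter subgroups: the diagonal torus shows that weights are
preserved, and the rotations give a recurrence which determines an intertwiner from one of its
entries. Two isometric intertwiners thus differ by a phase, which the channel does not see.

*The equivalence.* An entanglement-breaking map is PPT since the transpose of a state is a state
(`IsEBT.isPPT`). If `Φ_p` is PPT, then evaluating the partially transposed Choi matrix at
`|0⟩ ⊗ |1⟩ - √l |1⟩ ⊗ |0⟩` gives `1 / (l + 1) ≤ p` (`le_of_isPPT_cgMixture`). If
`1 / (l + 1) ≤ p ≤ 1`, then `Φ_p` is a mixture of the two endpoints `Φ_{1/(l+1)}` and `Φ_1`. These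
measure a qubit against the coherent states and prepare the corresponding, respectively the
antipodal, coherent state of `H_l` (`choi_cgMixture_left`, `choi_cgMixture_one`), so it remains to
see that the average over the sphere of the product coherent states is a finite convex combination
(`isSeparable_coherentAverage`). It is an integral over a compact set of product states, and in
finite dimension the convex hull of a compact set is closed, by Carathéodory's theorem.
-/

/-! ### Multiplicity one and uniqueness of the channels -/

namespace SU2Channel
open Polynomial

/-- `f'` is the coefficientwise derivative at `0` of the curve `f` of polynomials. -/
def HasCoeffDerivAtZero (f : ℝ → ℂ[X]) (f' : ℂ[X]) : Prop :=
  ∀ n, HasDerivAt (fun t => (f t).coeff n) (f'.coeff n) 0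

lemma HasCoeffDerivAtZero.mul {f g : ℝ → ℂ[X]} {f' g' : ℂ[X]} (hf : HasCoeffDerivAtZero f f')
    (hg : HasCoeffDerivAtZero g g') :
    HasCoeffDerivAtZero (fun t => f t * g t) (f' * g 0 + f 0 * g') := by
  intro n
  simp only [coeff_add, coeff_mul, ← Finset.sum_add_distrib]
  exact HasDerivAt.fun_sum fun ij _ => (hf ij.1).mul (hg ij.2)

lemma HasCoeffDerivAtZero.pow {f : ℝ → ℂ[X]} {f' : ℂ[X]} (hf : HasCoeffDerivAtZero f f') (n : ℕ) :
    HasCoeffDerivAtZero (fun t => f t ^ n) ((n : ℂ[X]) * f 0 ^ (n - 1) * f') := by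
  induction n with
  | zero => intro m; simpa using hasDerivAt_const (0 : ℝ) _
  | succ n ih =>
    have e : (fun t => f t ^ (n + 1)) = fun t => f t ^ n * f t := funext fun t => pow_succ _ _
    rw [e]
    convert ih.mul hf using 1
    rcases n with _ | n
    · simp
    · simp only [Nat.add_sub_cancel]
      push_cast
      ring

/-- The derivative of `rep k` at the identity in the direction `ξ`. -/
noncomputable def drep (k : ℕ) (ξ : Matrix (Fin 2) (Fin 2) ℂ) : Op k :=
  Matrix.of fun j i =>
    ((Real.sqrt ((k.choose i : ℝ) / (k.choose j : ℝ)) : ℝ) : ℂ) *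
      (((k - (i : ℕ) : ℕ) : ℂ[X]) * (C (ξ 0 0) + C (ξ 1 0) * X) * X ^ (i : ℕ) +
        ((i : ℕ) : ℂ[X]) * X ^ ((i : ℕ) - 1) * (C (ξ 0 1) + C (ξ 1 1) * X)).coeff j

lemma rep_one (k : ℕ) : rep k 1 = 1 := by
  ext j i
  by_cases h : j = i
  · subst h
    simpa [rep] using (Nat.choose_pos (Nat.lt_succ_iff.1 j.2)).ne'
  · have : (j : ℕ) ≠ i := fun h' => h (Fin.ext h')
    simp [rep, coeff_X_pow, h, this]

lemma hasDerivAt_rep {x : ℝ → Matrix (Fin 2) (Fin 2) ℂ} {ξ : Matrix (Fin 2) (Fin 2) ℂ}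
    (x_zero : x 0 = 1) (hx : ∀ i j, HasDerivAt (fun t => x t i j) (ξ i j) 0) (k : ℕ)
    (j i : Fin (k + 1)) :
    HasDerivAt (fun t => rep k (x t) j i) (drep k ξ j i) 0 := by
  have lin : ∀ a, HasCoeffDerivAtZero (fun t => C (x t 0 a) + C (x t 1 a) * X)
      (C (ξ 0 a) + C (ξ 1 a) * X) := by
    intro a n
    simp only [coeff_add, coeff_C, coeff_C_mul, coeff_X]
    refine HasDerivAt.add ?_ ((hx 1 a).mul_const _)
    split_ifs
    · exact hx 0 a
    · exact hasDerivAt_const _ _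
  have h := ((lin 0).pow (k - i)).mul ((lin 1).pow i)
  have h' := (h j).const_mul ((Real.sqrt ((k.choose i : ℝ) / (k.choose j : ℝ)) : ℝ) : ℂ)
  simpa [drep, rep, x_zero] using h'

variable {l m : ℕ} {α β : Matrix (Fin (l + 1) × Fin (m + 1)) (Fin (1 + 1)) ℂ}

/-- `α : H_k → H_l ⊗ H_m` is a linear map intertwining `π_k` with `π_l ⊗ π_m`. -/
def IsIntertwiner (k l m : ℕ) (α : Matrix (Fin (l + 1) × Fin (m + 1)) (Fin (k + 1)) ℂ) : Prop :=
  ∀ x ∈ Matrix.specialUnitaryGroup (Fin 2) ℂ, (rep l x ⊗ₖ rep m x) * α = α * rep k x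

/-- An intertwiner of group representations intertwines their derivatives at the identity. -/
lemma IsIntertwiner.drep {k : ℕ} {α : Matrix (Fin (l + 1) × Fin (m + 1)) (Fin (k + 1)) ℂ}
    (hα : IsIntertwiner k l m α)
    {x : ℝ → Matrix (Fin 2) (Fin 2) ℂ} {ξ : Matrix (Fin 2) (Fin 2) ℂ}
    (x_mem : ∀ t, x t ∈ Matrix.specialUnitaryGroup (Fin 2) ℂ)
    (x_zero : x 0 = 1) (hx : ∀ i j, HasDerivAt (fun t => x t i j) (ξ i j) 0)
    (i : Fin (l + 1)) (j : Fin (m + 1)) (a : Fin (k + 1)) :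
    ∑ i', drep l ξ i i' * α (i', j) a + ∑ j', drep m ξ j j' * α (i, j') a =
      ∑ b, α (i, j) b * drep k ξ b a := by
  have h1 : HasDerivAt (fun t => (α * rep k (x t)) (i, j) a)
      (∑ b, α (i, j) b * SU2Channel.drep k ξ b a) 0 := by
    simp only [Matrix.mul_apply]
    exact HasDerivAt.fun_sum fun b _ => (hasDerivAt_rep x_zero hx k b a).const_mul _
  have h2 : HasDerivAt (fun t => ((rep l (x t) ⊗ₖ rep m (x t)) * α) (i, j) a)
      (∑ p : Fin (l + 1) × Fin (m + 1),
        (SU2Channel.drep l ξ i p.1 * rep m (x 0) j p.2 +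
          rep l (x 0) i p.1 * SU2Channel.drep m ξ j p.2) * α p a) 0 := by
    simp only [Matrix.mul_apply, Matrix.kroneckerMap_apply]
    exact HasDerivAt.fun_sum fun p _ =>
      ((hasDerivAt_rep x_zero hx l i p.1).mul (hasDerivAt_rep x_zero hx m j p.2)).mul_const _
  have h3 : (fun t => ((rep l (x t) ⊗ₖ rep m (x t)) * α) (i, j) a) =
      fun t => (α * rep k (x t)) (i, j) a := funext fun t => by rw [hα _ (x_mem t)]
  rw [h3] at h2
  rw [← h2.unique h1]
  simp only [x_zero, rep_one, add_mul, Finset.sum_add_distrib, Fintype.sum_prod_type,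
    Matrix.one_apply, mul_ite, ite_mul, mul_one, mul_zero, one_mul, zero_mul, Finset.sum_ite_eq,
    Finset.mem_univ, if_true]
  congr 1
  rw [Finset.sum_comm]
  simp

/-- Weights are preserved: the derivative along the diagonal torus forces `α` to have only
entries with matching weights. -/
lemma IsIntertwiner.apply_eq_zero {d : ℕ} (hlm : l + m = 2 * d + 1) (hα : IsIntertwiner 1 l m α)
    (i : Fin (l + 1)) (j : Fin (m + 1)) (a : Fin (1 + 1)) (h : (i : ℕ) + j ≠ d + a) :
    α (i, j) a = 0 := by
  have key := hα.drep (x := fun t : ℝ => !![Complex.exp (t * Complex.I), 0;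
      0, Complex.exp (-(t * Complex.I))]) (ξ := !![Complex.I, 0; 0, -Complex.I]) ?_ ?_ ?_ i j a
  · have hd : ∀ (k : ℕ) (i i' : Fin (k + 1)),
        SU2Channel.drep k !![Complex.I, 0; 0, -Complex.I] i i' =
          if i = i' then ((k : ℂ) - 2 * (i : ℕ)) * Complex.I else 0 := by
      intro k i i'
      have hp : (((k - (i' : ℕ) : ℕ) : ℂ[X]) * (C Complex.I + C 0 * X) * X ^ (i' : ℕ) +
          ((i' : ℕ) : ℂ[X]) * X ^ ((i' : ℕ) - 1) * (C 0 + C (-Complex.I) * X)) =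
          C (((k : ℂ) - 2 * (i' : ℕ)) * Complex.I) * X ^ (i' : ℕ) := by
        rw [Nat.cast_sub (Nat.lt_succ_iff.1 i'.2)]
        rcases (i' : ℕ) with _ | n
        · simp
        · simp only [Nat.add_sub_cancel, map_neg, map_mul, map_sub, map_zero, zero_mul, add_zero,
            zero_add]
          push_cast
          simp only [map_ofNat, map_add, map_natCast, map_one]
          ring
      simp only [SU2Channel.drep, Matrix.of_apply, Matrix.cons_val', Matrix.cons_val_zero,
        Matrix.cons_val_one, Matrix.cons_val_fin_one, hp, coeff_C_mul, coeff_X_pow]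
      by_cases h : i = i'
      · subst h
        have : ((k.choose i : ℕ) : ℝ) ≠ 0 :=
          Nat.cast_ne_zero.2 (Nat.choose_pos (Nat.lt_succ_iff.1 i.2)).ne'
        simp [div_self this]
      · have : (i : ℕ) ≠ i' := fun h' => h (Fin.ext h')
        simp [h, this]
    simp only [hd, ite_mul, mul_ite, zero_mul, mul_zero, Finset.sum_ite_eq, Finset.sum_ite_eq',
      Finset.mem_univ, if_true] at key
    have h0 : ((l : ℂ) + m - 1 - 2 * ((i : ℕ) + (j : ℕ)) + 2 * (a : ℕ)) * α (i, j) a = 0 := by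
      have : Complex.I *
          (((l : ℂ) + m - 1 - 2 * ((i : ℕ) + (j : ℕ)) + 2 * (a : ℕ)) * α (i, j) a) = 0 := by
        push_cast at key
        linear_combination key
      exact (mul_eq_zero.1 this).resolve_left Complex.I_ne_zero
    refine (mul_eq_zero.1 h0).resolve_left fun h1 => h ?_
    have h2 : ((l + m : ℕ) : ℂ) = 2 * d + 1 := by rw [hlm]; push_cast; ring
    push_cast at h2
    have h3 : (((i : ℕ) + (j : ℕ) : ℕ) : ℂ) = ((d + (a : ℕ) : ℕ) : ℂ) := by
      push_cast
      linear_combination (h2 - h1) / 2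
    exact_mod_cast h3
  · intro t
    rw [Matrix.mem_specialUnitaryGroup_iff, Matrix.mem_unitaryGroup_iff]
    refine ⟨?_, by simp [Matrix.det_fin_two, ← Complex.exp_add]⟩
    ext a b
    fin_cases a <;> fin_cases b <;>
      simp [Matrix.mul_apply, Matrix.star_apply, ← Complex.exp_conj, ← Complex.exp_add]
  · ext a b
    fin_cases a <;> fin_cases b <;> simp
  · have h1 : HasDerivAt (fun t : ℝ => (t : ℂ) * Complex.I) Complex.I 0 := by
      simpa using (Complex.ofRealCLM.hasDerivAt (x := (0 : ℝ))).mul_const Complex.I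
    intro a b
    fin_cases a <;> fin_cases b
    · simpa using h1.cexp
    · simpa using hasDerivAt_const (0 : ℝ) (0 : ℂ)
    · simpa using hasDerivAt_const (0 : ℝ) (0 : ℂ)
    · simpa using h1.neg.cexp

/-- Multiplicity one: an intertwiner `H_1 → H_l ⊗ H_m`, where `l + m = 2 d + 1`, is determined by
a single entry. The derivative along the rotation subgroup gives a two-term recurrence for the
first column, and expresses the second column through the first. -/
lemma IsIntertwiner.eq_zero {d : ℕ} (hlm : l + m = 2 * d + 1) (hm : d ≤ m)
    (hα : IsIntertwiner 1 l m α)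
    (h : α (0, ⟨d, Nat.lt_succ_iff.2 hm⟩) 0 = 0) : α = 0 := by
  have key := fun i j a => hα.drep
    (x := fun t : ℝ => !![Complex.cos t, Complex.sin t; -Complex.sin t, Complex.cos t])
    (ξ := !![0, 1; -1, 0]) ?_ ?_ ?_ i j a
  · have hd : ∀ (k : ℕ) (i i' : Fin (k + 1)), (i' : ℕ) = i + 1 →
        SU2Channel.drep k !![0, 1; -1, 0] i i' ≠ 0 := by
      intro k i i' h
      have h1 : 0 < ((k.choose i : ℕ) : ℝ) :=
        Nat.cast_pos.2 (Nat.choose_pos (Nat.lt_succ_iff.1 i.2))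
      have h2 : 0 < ((k.choose i' : ℕ) : ℝ) :=
        Nat.cast_pos.2 (Nat.choose_pos (Nat.lt_succ_iff.1 i'.2))
      have h3 : (((k - (i' : ℕ) : ℕ) : ℂ[X]) * (C 0 + C (-1) * X) * X ^ (i' : ℕ) +
          ((i' : ℕ) : ℂ[X]) * X ^ ((i' : ℕ) - 1) * (C 1 + C 0 * X)) =
          C (-((k - (i' : ℕ) : ℕ) : ℂ)) * X ^ ((i : ℕ) + 2) +
            C (((i : ℕ) + 1 : ℂ)) * X ^ (i : ℕ) := by
        rw [h]
        simp only [Nat.add_sub_cancel, map_zero, zero_mul, add_zero, zero_add, map_neg, map_one,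
          map_natCast, map_add]
        push_cast
        ring
      simp only [SU2Channel.drep, Matrix.of_apply, Matrix.cons_val', Matrix.cons_val_zero,
        Matrix.cons_val_one, Matrix.cons_val_fin_one]
      rw [h3, coeff_add, coeff_C_mul, coeff_C_mul, coeff_X_pow, coeff_X_pow]
      refine mul_ne_zero (Complex.ofReal_ne_zero.2 (Real.sqrt_pos.2 (div_pos h2 h1)).ne') ?_
      simpa using Nat.cast_add_one_ne_zero (R := ℂ) (i : ℕ)
    have h10 : SU2Channel.drep 1 !![0, 1; -1, 0] 1 0 = -1 := by
      simp [SU2Channel.drep]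
    have h00 : SU2Channel.drep 1 !![0, 1; -1, 0] 0 0 = 0 := by
      simp [SU2Channel.drep]
    -- In the row `(i, j)` with `i + j = d - 1`, the relation expresses the entry `(i + 1, j)` of the
    -- first column through its entry `(i, j + 1)`.
    have col0 : ∀ (n : ℕ) (i : Fin (l + 1)) (j : Fin (m + 1)), (i : ℕ) = n →
        α (i, j) 0 = 0 := by
      intro n
      induction n with
      | zero =>
        intro i j hi
        have hi : i = 0 := Fin.ext hi
        subst hi
        by_cases hj : (j : ℕ) = d
        · have : j = ⟨d, Nat.lt_succ_iff.2 hm⟩ := Fin.ext hj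
          rwa [this]
        · exact hα.apply_eq_zero hlm _ _ _ (by simpa using hj)
      | succ n ih =>
        intro i j hi
        by_cases hj : (i : ℕ) + j = d
        · have hn : n < l + 1 := by have := i.2; omega
          have k1 := key ⟨n, hn⟩ j 0
          rw [Fin.sum_univ_two, h10, h00, hα.apply_eq_zero hlm _ _ 1 (by simp; omega),
            Finset.sum_eq_zero (s := Finset.univ) (f := fun j' : Fin (m + 1) => _ * _)
              (fun j' _ => by rw [ih _ _ rfl, mul_zero]),
            Finset.sum_eq_single i] at k1
          · simpa [hd l ⟨n, hn⟩ i hi] using k1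
          · intro i' _ hi'
            rw [hα.apply_eq_zero hlm, mul_zero]
            intro h'
            refine hi' (Fin.ext ?_)
            simp at h'
            omega
          · simp
        · exact hα.apply_eq_zero hlm _ _ _ (by simpa using hj)
    ext ⟨i, j⟩ a
    fin_cases a
    · exact col0 _ i j rfl
    · have k1 := key i j 0
      rw [Fin.sum_univ_two, h10, h00] at k1
      simpa [col0 _ _ _ rfl] using k1
  · intro t
    rw [Matrix.mem_specialUnitaryGroup_iff, Matrix.mem_unitaryGroup_iff]
    have hs := Complex.sin_sq_add_cos_sq (t : ℂ)
    refine ⟨?_, by rw [Matrix.det_fin_two]; simp; linear_combination hs⟩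
    ext a b
    fin_cases a <;> fin_cases b <;>
      simp [Matrix.mul_apply, Matrix.star_apply, ← Complex.cos_conj, ← Complex.sin_conj] <;>
      first | linear_combination hs | ring
  · ext a b
    fin_cases a <;> fin_cases b <;> simp
  · have hc : HasDerivAt (fun t : ℝ => Complex.cos t) 0 0 := by
      simpa using (Complex.hasDerivAt_cos (0 : ℝ)).comp_ofReal
    have hs : HasDerivAt (fun t : ℝ => Complex.sin t) 1 0 := by
      simpa using (Complex.hasDerivAt_sin (0 : ℝ)).comp_ofReal
    intro a b
    fin_cases a <;> fin_cases b
    · simpa using hc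
    · simpa using hs
    · simpa using hs.fun_neg
    · simpa using hc

/-- The Clebsch-Gordan channel does not depend on the isometric intertwiner: two of them differ
by a phase. -/
lemma IsClebschGordanIsometry.stinespring_eq {d : ℕ} (hlm : l + m = 2 * d + 1)
    (hm : d ≤ m) (hα : IsClebschGordanIsometry 1 l m α) (hβ : IsClebschGordanIsometry 1 l m β) :
    stinespring β = stinespring α := by
  set e : Fin (l + 1) × Fin (m + 1) := (0, ⟨d, Nat.lt_succ_iff.2 hm⟩) with he
  have h0 : α e 0 ≠ 0 := by
    intro h
    have h1 := hα.1
    rw [IsIntertwiner.eq_zero hlm hm hα.2 h] at h1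
    simpa using congrFun (congrFun h1 0) 0
  obtain ⟨c, hc⟩ : ∃ c : ℂ, β e 0 = c * α e 0 := ⟨β e 0 / α e 0, (div_mul_cancel₀ _ h0).symm⟩
  have hβα : β = c • α := by
    refine sub_eq_zero.1 (IsIntertwiner.eq_zero (d := d) hlm hm ?_ ?_)
    · intro x hx
      rw [Matrix.mul_sub, Matrix.mul_smul, hα.2 x hx, hβ.2 x hx, Matrix.sub_mul, Matrix.smul_mul]
    · simpa [he, sub_eq_zero] using hc
  have hcc : c * star c = 1 := by
    have h1 := hβ.1
    rw [hβα, Matrix.conjTranspose_smul, Matrix.smul_mul, Matrix.mul_smul, hα.1] at h1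
    simpa [mul_comm] using congrFun (congrFun h1 0) 0
  refine LinearMap.ext fun Y => ?_
  simp only [stinespring, LinearMap.coe_mk, AddHom.coe_mk]
  rw [hβα, Matrix.conjTranspose_smul, Matrix.smul_mul, Matrix.smul_mul, Matrix.mul_smul, smul_smul,
    hcc, one_smul]

end SU2Channel

/-! ### The isometric intertwiners -/

namespace SU2Channel
open Polynomial

/-- The factor which turns a coefficient at `X^i Y^m` of `(Y - X)^d Y^a` into an entry of
`cgIsometry`. It accounts for the norm of the monomial in `H_d ⊗ H_{d+1}` and for the overall
normalisation. -/
noncomputable def cgNorm (d i m : ℕ) : ℝ :=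
  √(2 / ((d + 2) * d.choose i * (d + 1).choose m))

/-- The isometric intertwiner `H_1 → H_d ⊗ H_{d+1}`: up to normalisation, it sends the basis vector
`|a⟩` to the bihomogeneous polynomial `(Y - X)^d Y^a`, written with the variables dehomogenised. -/
noncomputable def cgIsometry (d : ℕ) : Matrix (Fin (d + 1) × Fin (d + 1 + 1)) (Fin (1 + 1)) ℂ :=
  Matrix.of fun p a => if (p.1 : ℕ) + p.2 = d + a then
    (-1) ^ (p.1 : ℕ) * (d.choose p.1 : ℂ) * (cgNorm d p.1 p.2 : ℂ) else 0

lemma cgNorm_rescale {d i i' m m' : ℕ} (hi : i ≤ d) (hi' : i' ≤ d) (hm : m ≤ d + 1)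
    (hm' : m' ≤ d + 1) :
    √((d.choose i' : ℝ) / d.choose i) * √(((d + 1).choose m' : ℝ) / (d + 1).choose m) *
      cgNorm d i' m' = cgNorm d i m := by
  have h1 : (0 : ℝ) < d.choose i := Nat.cast_pos.2 (Nat.choose_pos hi)
  have h2 : (0 : ℝ) < d.choose i' := Nat.cast_pos.2 (Nat.choose_pos hi')
  have h3 : (0 : ℝ) < (d + 1).choose m := Nat.cast_pos.2 (Nat.choose_pos hm)
  have h4 : (0 : ℝ) < (d + 1).choose m' := Nat.cast_pos.2 (Nat.choose_pos hm')
  unfold cgNorm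
  rw [← Real.sqrt_mul (by positivity), ← Real.sqrt_mul (by positivity)]
  congr 1
  field_simp

/-- The coefficientwise form of `(P(X) Q(Y) - Q(X) P(Y))^d R(Y) = (Y - X)^d R(Y)` for the columns
`P`, `Q` of a matrix of determinant one. -/
lemma sum_coeff_det_pow {x : Matrix (Fin 2) (Fin 2) ℂ} (hx : x.det = 1) (d i m : ℕ) (hi : i ≤ d)
    (R : ℂ[X]) :
    ∑ n ∈ Finset.range (d + 1), (-1) ^ n * (d.choose n : ℂ) *
      ((C (x 0 0) + C (x 1 0) * X) ^ (d - n) * (C (x 0 1) + C (x 1 1) * X) ^ n).coeff i *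
      ((C (x 0 0) + C (x 1 0) * X) ^ n * (C (x 0 1) + C (x 1 1) * X) ^ (d - n) * R).coeff m =
    (-1) ^ i * (d.choose i : ℂ) * (X ^ (d - i) * R).coeff m := by
  set P : ℂ[X] := C (x 0 0) + C (x 1 0) * X with hP
  set Q : ℂ[X] := C (x 0 1) + C (x 1 1) * X with hQ
  have hdet : -(C Q * P.map C) + C P * Q.map C = (-C (X : ℂ[X]) + X : ℂ[X][X]) := by
    have h : (C (C (x 0 0)) * C (C (x 1 1)) - C (C (x 0 1)) * C (C (x 1 0)) : ℂ[X][X]) = 1 := by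
      rw [Matrix.det_fin_two] at hx
      rw [← map_mul, ← map_mul, ← map_mul, ← map_mul, ← map_sub, ← map_sub, hx, map_one, map_one]
    simp only [hP, hQ, map_add, map_mul, Polynomial.map_add, Polynomial.map_mul, Polynomial.map_C,
      Polynomial.map_X]
    linear_combination (X - C X) * h
  have hc : ∀ p q : ℂ[X], ((C p * q.map C : ℂ[X][X]).coeff m).coeff i = p.coeff i * q.coeff m := by
    intro p q
    rw [coeff_C_mul, coeff_map, coeff_mul_C]
  have hneg : ∀ (z : ℂ[X][X]) (n : ℕ), (-z) ^ n = (-1) ^ n * z ^ n := fun z n => neg_pow z n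
  have key : (((-(C Q * P.map C) + C P * Q.map C) ^ d * R.map C).coeff m).coeff i =
      (((-C (X : ℂ[X]) + X : ℂ[X][X]) ^ d * R.map C).coeff m).coeff i := by rw [hdet]
  rw [add_pow, add_pow, Finset.sum_mul, Finset.sum_mul] at key
  simp only [finsetSum_coeff] at key
  have hl : ∀ n ∈ Finset.range (d + 1),
      (((-(C Q * P.map C)) ^ n * (C P * Q.map C) ^ (d - n) * (d.choose n : ℂ[X][X]) *
        R.map C).coeff m).coeff i =
      (-1) ^ n * (d.choose n : ℂ) * (P ^ (d - n) * Q ^ n).coeff i *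
        (P ^ n * Q ^ (d - n) * R).coeff m := by
    intro n _
    have : (-(C Q * P.map C)) ^ n * (C P * Q.map C) ^ (d - n) * (d.choose n : ℂ[X][X]) * R.map C =
        C (C ((-1) ^ n * (d.choose n : ℂ)) * (P ^ (d - n) * Q ^ n)) *
          (P ^ n * Q ^ (d - n) * R).map C := by
      simp only [map_mul, map_pow, map_neg, map_one, map_natCast, Polynomial.map_mul,
        Polynomial.map_pow]
      rw [hneg]
      ring
    rw [this, hc, coeff_C_mul]
  have hr : ∀ n ∈ Finset.range (d + 1),
      (((-C (X : ℂ[X]) : ℂ[X][X]) ^ n * X ^ (d - n) * (d.choose n : ℂ[X][X]) * R.map C).coeff m).coeff i =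
      if i = n then (-1) ^ n * (d.choose n : ℂ) * (X ^ (d - n) * R).coeff m else 0 := by
    intro n _
    have : (-C (X : ℂ[X]) : ℂ[X][X]) ^ n * X ^ (d - n) * (d.choose n : ℂ[X][X]) * R.map C =
        C (C ((-1) ^ n * (d.choose n : ℂ)) * X ^ n) * (X ^ (d - n) * R).map C := by
      simp only [map_mul, map_pow, map_neg, map_one, map_natCast, Polynomial.map_mul,
        Polynomial.map_pow, Polynomial.map_X]
      rw [hneg]
      ring
    rw [this, hc, coeff_C_mul, coeff_X_pow]
    split_ifs <;> simp
  rw [Finset.sum_congr rfl hl, Finset.sum_congr rfl hr, Finset.sum_ite_eq,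
    if_pos (Finset.mem_range.2 (by omega))] at key
  exact key

lemma isIntertwiner_cgIsometry (d : ℕ) : IsIntertwiner 1 d (d + 1) (cgIsometry d) := by
  intro x hx
  have hdet : x.det = 1 := (Matrix.mem_specialUnitaryGroup_iff.1 hx).2
  ext ⟨i, m⟩ a
  have hi := i.2
  have hm := m.2
  have ha := a.2
  set P : ℂ[X] := C (x 0 0) + C (x 1 0) * X with hP
  set Q : ℂ[X] := C (x 0 1) + C (x 1 1) * X with hQ
  set R : ℂ[X] := P ^ (1 - (a : ℕ)) * Q ^ (a : ℕ) with hR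
  -- The left side is a multiple of a coefficient of `(P(X) Q(Y) - Q(X) P(Y))^d R(Y)`.
  have hleft : ((rep d x ⊗ₖ rep (d + 1) x) * cgIsometry d) (i, m) a =
      (cgNorm d i m : ℂ) * ∑ n ∈ Finset.range (d + 1), (-1) ^ n * (d.choose n : ℂ) *
        (P ^ (d - n) * Q ^ n).coeff i * (P ^ n * Q ^ (d - n) * R).coeff m := by
    rw [Matrix.mul_apply, Fintype.sum_prod_type, Finset.mul_sum, ← Fin.sum_univ_eq_sum_range
      (fun n => (cgNorm d i m : ℂ) * ((-1) ^ n * (d.choose n : ℂ) *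
        (P ^ (d - n) * Q ^ n).coeff i * (P ^ n * Q ^ (d - n) * R).coeff m))]
    refine Finset.sum_congr rfl fun n _ => ?_
    have hn := n.2
    rw [Finset.sum_eq_single (⟨d + a - n, by omega⟩ : Fin (d + 1 + 1))]
    · have h1 : (n : ℕ) + (d + a - n) = d + a := by omega
      have h2 : P ^ (d + 1 - (d + a - n)) * Q ^ (d + a - n) =
          P ^ (n : ℕ) * Q ^ (d - (n : ℕ)) * R := by
        rw [hR, show d + 1 - (d + a - n) = n + (1 - a) by omega,
          show d + a - n = (d - n) + a by omega, pow_add, pow_add]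
        ring
      rw [← cgNorm_rescale (i := i) (i' := n) (m := m) (m' := d + a - n) (by omega) (by omega)
        (by omega) (by omega)]
      simp only [Matrix.kroneckerMap_apply, rep, cgIsometry, Matrix.of_apply, if_pos h1, ← hP, ← hQ,
        h2]
      push_cast
      ring
    · intro m' _ hm'
      have : ¬ ((n : ℕ) + m' = d + a) := fun h => hm' (Fin.ext (by simp; omega))
      simp [cgIsometry, this]
    · simp
  have hdeg : ∀ n, 2 ≤ n → R.coeff n = 0 := by
    intro n hn
    have h0 : n ≠ 0 := by omega
    have h1 : 1 ≠ n := by omega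
    fin_cases a <;> simp [hR, hP, hQ, coeff_C, coeff_X, h0, h1]
  rw [hleft, sum_coeff_det_pow hdet d i m (by omega), Matrix.mul_apply, Fin.sum_univ_two,
    coeff_X_pow_mul']
  have hrep : ∀ b : Fin (1 + 1), rep 1 x b a = R.coeff b := by
    intro b
    have h1 : ∀ c : Fin (1 + 1), Nat.choose 1 c = 1 := by intro c; fin_cases c <;> rfl
    simp [rep, h1, hR, hP, hQ]
  simp only [hrep, cgIsometry, Matrix.of_apply]
  by_cases h0 : (i : ℕ) + m = d
  · simp [h0, show d - (i : ℕ) ≤ m by omega, show (m : ℕ) - (d - i) = 0 by omega]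
    ring
  · by_cases h1 : (i : ℕ) + m = d + 1
    · simp [h1, show d - (i : ℕ) ≤ m by omega, show (m : ℕ) - (d - i) = 1 by omega]
      ring
    · by_cases h2 : d - (i : ℕ) ≤ m
      · simp [h0, h1, hdeg (m - (d - i)) (by omega)]
      · simp [h0, h1, h2]

/-- The square root of the probability that `cgIsometry d` assigns, in the column `a`, to the
`i`-th basis vector of the factor `H_d`. -/
noncomputable def cgAmplitude (d a i : ℕ) : ℝ :=
  √(2 * (if a = 0 then (i + 1 : ℝ) else d + 1 - i) / ((d + 1) * (d + 2)))

lemma choose_div_choose_succ_succ {n i : ℕ} (hi : i ≤ n) :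
    (n.choose i : ℝ) / (n + 1).choose (i + 1) = (i + 1) / (n + 1) := by
  have h1 : (0 : ℝ) < (n + 1).choose (i + 1) := Nat.cast_pos.2 (Nat.choose_pos (by omega))
  rw [div_eq_div_iff h1.ne' (by positivity)]
  have := Nat.add_one_mul_choose_eq n i
  rify at this
  linarith

lemma choose_div_choose_succ {n i : ℕ} (hi : i ≤ n) :
    (n.choose i : ℝ) / (n + 1).choose i = (n + 1 - i) / (n + 1) := by
  have h := choose_div_choose_succ_succ (n := n) (i := n - i) (by omega)
  rw [Nat.choose_symm hi, show n - i + 1 = n + 1 - i by omega,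
    Nat.choose_symm (show i ≤ n + 1 by omega)] at h
  rw [h]
  push_cast [hi]
  ring

lemma choose_mul_cgNorm {d i m a : ℕ} (hi : i ≤ d) (ha : a ≤ 1) (h : i + m = d + a) :
    d.choose i * cgNorm d i m = cgAmplitude d a i := by
  have h1 : (0 : ℝ) < d.choose i := Nat.cast_pos.2 (Nat.choose_pos hi)
  have h2 : (0 : ℝ) < (d + 1).choose m := Nat.cast_pos.2 (Nat.choose_pos (by omega))
  have h3 : (d.choose i : ℝ) / (d + 1).choose m =
      (if a = 0 then (i + 1 : ℝ) else d + 1 - i) / (d + 1) := by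
    rw [← Nat.choose_symm (show m ≤ d + 1 by omega)]
    interval_cases a
    · rw [if_pos rfl, show d + 1 - m = i + 1 by omega, choose_div_choose_succ_succ hi]
    · rw [if_neg one_ne_zero, show d + 1 - m = i by omega, choose_div_choose_succ hi]
  rw [cgNorm, cgAmplitude, ← Real.sqrt_sq h1.le, ← Real.sqrt_mul (by positivity), Real.sqrt_sq h1.le]
  congr 1
  calc (d.choose i : ℝ) ^ 2 * (2 / ((d + 2) * d.choose i * (d + 1).choose m))
      = 2 * ((d.choose i : ℝ) / (d + 1).choose m) / (d + 2) := by field_simp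
    _ = _ := by rw [h3]; field_simp

lemma cgIsometry_apply (d : ℕ) (i : Fin (d + 1)) (m : Fin (d + 1 + 1)) (a : Fin (1 + 1)) :
    cgIsometry d (i, m) a =
      if (i : ℕ) + m = d + a then (-1) ^ (i : ℕ) * (cgAmplitude d a i : ℂ) else 0 := by
  simp only [cgIsometry, Matrix.of_apply]
  split_ifs with h
  · rw [← choose_mul_cgNorm (Nat.lt_succ_iff.1 i.2) (Nat.lt_succ_iff.1 a.2) h]
    push_cast
    ring
  · rfl

lemma cgAmplitude_sq {d a i : ℕ} (hi : i ≤ d + 1) : cgAmplitude d a i ^ 2 =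
    2 * (if a = 0 then (i + 1 : ℝ) else d + 1 - i) / ((d + 1) * (d + 2)) := by
  have : (i : ℝ) ≤ d + 1 := by exact_mod_cast hi
  refine Real.sq_sqrt ?_
  split_ifs
  · positivity
  · have : (0 : ℝ) ≤ d + 1 - i := by linarith
    positivity

lemma sum_cgAmplitude_sq (d a : ℕ) : ∑ i : Fin (d + 1), cgAmplitude d a i ^ 2 = 1 := by
  have hs : ∀ n : ℕ, ∑ i ∈ Finset.range n, (i : ℝ) = n * (n - 1) / 2 := by
    intro n
    induction n with
    | zero => simp
    | succ n ih => rw [Finset.sum_range_succ, ih]; push_cast; ring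
  have h : ∀ i : Fin (d + 1), _ := fun i => cgAmplitude_sq (d := d) (a := a) (i := i) (by omega)
  simp only [h]
  rw [← Finset.sum_div, ← Finset.mul_sum]
  rw [div_eq_one_iff_eq (by positivity)]
  split_ifs
  · rw [Fin.sum_univ_eq_sum_range (fun i => (i + 1 : ℝ)), Finset.sum_add_distrib, hs]
    simp
    ring
  · rw [Fin.sum_univ_eq_sum_range (fun i => (d + 1 - i : ℝ)), Finset.sum_sub_distrib, hs]
    simp
    ring

lemma conjTranspose_cgIsometry_mul_self (d : ℕ) :
    (cgIsometry d).conjTranspose * cgIsometry d = 1 := by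
  ext a b
  rw [Matrix.mul_apply, Fintype.sum_prod_type]
  simp only [Matrix.conjTranspose_apply, cgIsometry_apply]
  by_cases h : a = b
  · subst h
    rw [Matrix.one_apply_eq]
    have : ∀ i : Fin (d + 1), (∑ m : Fin (d + 1 + 1),
        star (if (i : ℕ) + m = d + a then (-1) ^ (i : ℕ) * (cgAmplitude d a i : ℂ) else 0) *
          (if (i : ℕ) + m = d + a then (-1) ^ (i : ℕ) * (cgAmplitude d a i : ℂ) else 0)) =
        ((cgAmplitude d a i ^ 2 : ℝ) : ℂ) := by
      intro i
      have hi := i.2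
      have ha := a.2
      rw [Finset.sum_eq_single (⟨d + a - i, by omega⟩ : Fin (d + 1 + 1))]
      · rw [if_pos (by simp; omega)]
        have : ((-1 : ℂ) ^ (i : ℕ)) * (-1) ^ (i : ℕ) = 1 := by
          rw [← mul_pow]; simp
        simp
        linear_combination (cgAmplitude d a i : ℂ) ^ 2 * this
      · intro m _ hm
        rw [if_neg fun h' => hm (Fin.ext (by simp; omega)), mul_zero]
      · simp
    rw [Finset.sum_congr rfl fun i _ => this i, ← Complex.ofReal_sum, sum_cgAmplitude_sq,
      Complex.ofReal_one]
  · rw [Matrix.one_apply_ne h]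
    refine Finset.sum_eq_zero fun i _ => Finset.sum_eq_zero fun m _ => ?_
    by_cases h1 : (i : ℕ) + m = d + a
    · rw [if_neg (fun h2 => h (Fin.ext (by omega))) (c := (i : ℕ) + m = d + b), mul_zero]
    · rw [if_neg h1, star_zero, zero_mul]

lemma isClebschGordanIsometry_cgIsometry (d : ℕ) :
    IsClebschGordanIsometry 1 d (d + 1) (cgIsometry d) :=
  ⟨conjTranspose_cgIsometry_mul_self d, isIntertwiner_cgIsometry d⟩

/-- Exchanging the tensor factors of the codomain. -/
lemma IsClebschGordanIsometry.swap {k l m : ℕ}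
    {α : Matrix (Fin (l + 1) × Fin (m + 1)) (Fin (k + 1)) ℂ} (h : IsClebschGordanIsometry k l m α) :
    IsClebschGordanIsometry k m l (α.submatrix Prod.swap id) := by
  refine ⟨?_, fun x hx => ?_⟩
  · rw [← h.1]
    ext a b
    simp only [Matrix.mul_apply, Matrix.conjTranspose_apply, Matrix.submatrix_apply, id]
    exact (Equiv.prodComm _ _).sum_comp fun p => star (α p a) * α p b
  · ext ⟨j, i⟩ a
    have := congrFun (congrFun (h.2 x hx) (i, j)) a
    rw [Matrix.mul_apply] at this ⊢
    refine Eq.trans ?_ (this.trans ?_)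
    · rw [← (Equiv.prodComm _ _).sum_comp]
      simp [mul_comm (rep l x i _)]
    · simp [Matrix.mul_apply]

end SU2Channel

/-! ### Choi matrices and positive partial transpose -/

namespace SU2Channel

lemma choi_apply {k l : ℕ} (Φ : Op k →ₗ[ℂ] Op l) (a b : Fin (k + 1)) (i j : Fin (l + 1)) :
    choi Φ (a, i) (b, j) = Φ (Matrix.single a b 1) i j := by
  simp only [choi, Matrix.sum_apply, Matrix.kroneckerMap_apply]
  rw [Finset.sum_eq_single a, Finset.sum_eq_single b]
  · simp
  · intro b' _ h
    simp [h]
  · simp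
  · intro a' _ h
    simp [h]
  · simp

lemma choi_stinespring_apply {k l m : ℕ} (α : Matrix (Fin (l + 1) × Fin (m + 1)) (Fin (k + 1)) ℂ)
    (a b : Fin (k + 1)) (i j : Fin (l + 1)) :
    choi (stinespring α) (a, i) (b, j) = ∑ n, α (i, n) a * star (α (j, n) b) := by
  rw [choi_apply]
  simp only [stinespring, LinearMap.coe_mk, AddHom.coe_mk, partialTraceRight, Matrix.of_apply]
  refine Finset.sum_congr rfl fun n _ => ?_
  rw [Matrix.mul_apply, Finset.sum_eq_single b]
  · rw [Matrix.mul_apply, Finset.sum_eq_single a]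
    · simp
    · intro a' _ h
      simp [h.symm]
    · simp
  · intro b' _ h
    rw [Matrix.mul_apply, Finset.sum_eq_zero, zero_mul]
    intro a' _
    simp [h.symm]
  · simp

/-- The Choi matrix of the Clebsch-Gordan channel `Φ^{1→l}_{l+1}`. -/
lemma choi_stinespring_cgIsometry (l : ℕ) (a b : Fin (1 + 1)) (i j : Fin (l + 1)) :
    choi (stinespring (cgIsometry l)) (a, i) (b, j) =
      if (a : ℕ) + j = b + i then
        (((-1) ^ ((a : ℕ) + b) * (cgAmplitude l a i * cgAmplitude l b j) : ℝ) : ℂ) else 0 := by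
  have hi := i.2
  have hj := j.2
  have ha := a.2
  rw [choi_stinespring_apply]
  simp only [cgIsometry_apply]
  split_ifs with h
  · have hsign : ((-1 : ℂ) ^ (i : ℕ)) * (-1) ^ (j : ℕ) = (-1) ^ ((a : ℕ) + b) := by
      rw [← pow_add, neg_one_pow_congr]
      grind
    rw [Finset.sum_eq_single (⟨l + a - i, by omega⟩ : Fin (l + 1 + 1))]
    · rw [if_pos (by simp; omega), if_pos (by simp; omega)]
      simp
      rw [← hsign]
      ring
    · intro n _ hn
      rw [if_neg fun h' => hn (Fin.ext (by simp; omega)), zero_mul]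
    · simp
  · refine Finset.sum_eq_zero fun n _ => ?_
    by_cases h1 : (i : ℕ) + n = l + a
    · rw [if_neg (c := (j : ℕ) + n = l + b) (by omega), star_zero, mul_zero]
    · rw [if_neg h1, zero_mul]

/-- The square root of the probability that the intertwiner `H_1 → H_{d+1} ⊗ H_d` assigns, in the
column `a`, to the `i`-th basis vector of the factor `H_{d+1}`. -/
noncomputable def cgAmplitudeSwap (d a i : ℕ) : ℝ :=
  √(2 * (if a = 0 then (d + 1 - i : ℝ) else i) / ((d + 1) * (d + 2)))

lemma cgAmplitudeSwap_sq {d a i : ℕ} (hi : i ≤ d + 1) : cgAmplitudeSwap d a i ^ 2 =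
    2 * (if a = 0 then (d + 1 - i : ℝ) else i) / ((d + 1) * (d + 2)) := by
  have : (i : ℝ) ≤ d + 1 := by exact_mod_cast hi
  refine Real.sq_sqrt ?_
  split_ifs
  · have : (0 : ℝ) ≤ d + 1 - i := by linarith
    positivity
  · positivity

lemma cgAmplitude_eq_swap {d a i m : ℕ} (ha : a ≤ 1) (h : m + i = d + a) :
    cgAmplitude d a m = cgAmplitudeSwap d a i := by
  have h' : (m : ℝ) + i = d + a := by exact_mod_cast h
  unfold cgAmplitude cgAmplitudeSwap
  congr 3
  interval_cases a
  · simp at h' ⊢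
    linarith
  · simp at h' ⊢
    linarith

/-- The Choi matrix of the Clebsch-Gordan channel `Φ^{1→d+1}_d`. -/
lemma choi_stinespring_cgIsometry_swap (d : ℕ) (a b : Fin (1 + 1)) (i j : Fin (d + 1 + 1)) :
    choi (stinespring ((cgIsometry d).submatrix Prod.swap id)) (a, i) (b, j) =
      if (a : ℕ) + j = b + i then
        ((cgAmplitudeSwap d a i * cgAmplitudeSwap d b j : ℝ) : ℂ) else 0 := by
  have hi := i.2
  have hj := j.2
  have ha := a.2
  have hb := b.2
  rw [choi_stinespring_apply]
  simp only [Matrix.submatrix_apply, Prod.swap_prod_mk, id, cgIsometry_apply]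
  split_ifs with h
  · by_cases hn : (i : ℕ) ≤ d + a ∧ d + a - i < d + 1
    · rw [Finset.sum_eq_single (⟨d + a - i, hn.2⟩ : Fin (d + 1))]
      · rw [if_pos (by simp; omega), if_pos (by simp; omega),
          cgAmplitude_eq_swap (i := i) (by omega) (by simp; omega),
          cgAmplitude_eq_swap (i := j) (by omega) (by simp; omega)]
        have : ((-1 : ℂ) ^ (d + a - (i : ℕ))) * (-1) ^ (d + a - (i : ℕ)) = 1 := by
          rw [← mul_pow]; simp
        simp
        linear_combination (cgAmplitudeSwap d a i * cgAmplitudeSwap d b j : ℂ) * this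
      · intro n _ hn
        rw [if_neg fun h' => hn (Fin.ext (by simp; omega)), zero_mul]
      · simp
    · -- The weight `i - a` does not occur in `H_d`; the amplitude vanishes there as well.
      have h0 : cgAmplitudeSwap d a i = 0 := by
        unfold cgAmplitudeSwap
        by_cases ha0 : (a : ℕ) = 0
        · have : (i : ℕ) = d + 1 := by omega
          simp [ha0, this]
        · have : (i : ℕ) = 0 := by omega
          simp [ha0, this]
      rw [h0, zero_mul, Complex.ofReal_zero]
      refine Finset.sum_eq_zero fun n _ => ?_
      rw [if_neg (by omega), zero_mul]
  · refine Finset.sum_eq_zero fun n _ => ?_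
    by_cases h1 : (n : ℕ) + i = d + a
    · rw [if_neg (c := (n : ℕ) + j = d + b) (by omega), star_zero, mul_zero]
    · rw [if_neg h1, zero_mul]

lemma IsClebschGordanChannel.eq_cgIsometry {l : ℕ} {Φ : Op 1 →ₗ[ℂ] Op l}
    (h : IsClebschGordanChannel 1 l (l + 1) Φ) : Φ = stinespring (cgIsometry l) := by
  obtain ⟨α, hα, rfl⟩ := h
  exact (isClebschGordanIsometry_cgIsometry l).stinespring_eq (d := l) (by ring) (by omega) hα

lemma IsClebschGordanChannel.eq_cgIsometry_swap {d : ℕ} {Φ : Op 1 →ₗ[ℂ] Op (d + 1)}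
    (h : IsClebschGordanChannel 1 (d + 1) d Φ) :
    Φ = stinespring ((cgIsometry d).submatrix Prod.swap id) := by
  obtain ⟨α, hα, rfl⟩ := h
  exact (isClebschGordanIsometry_cgIsometry d).swap.stinespring_eq (d := d) (by ring) le_rfl hα

/-- The mixture `(1 - p) Φ^{1→l}_{l-1} + p Φ^{1→l}_{l+1}` for `l = d + 1`. -/
noncomputable def cgMixture (d : ℕ) (p : ℝ) : Op 1 →ₗ[ℂ] Op (d + 1) :=
  ((1 - p : ℝ) : ℂ) • stinespring ((cgIsometry d).submatrix Prod.swap id) +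
    (p : ℂ) • stinespring (cgIsometry (d + 1))

lemma choi_cgMixture (d : ℕ) (p : ℝ) (a b : Fin (1 + 1)) (i j : Fin (d + 1 + 1)) :
    choi (cgMixture d p) (a, i) (b, j) =
      if (a : ℕ) + j = b + i then
        (((1 - p) * (cgAmplitudeSwap d a i * cgAmplitudeSwap d b j) +
          p * ((-1) ^ ((a : ℕ) + b) * (cgAmplitude (d + 1) a i * cgAmplitude (d + 1) b j)) : ℝ) : ℂ)
      else 0 := by
  have h1 := choi_stinespring_cgIsometry (d + 1) a b i j
  have h2 := choi_stinespring_cgIsometry_swap d a b i j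
  rw [choi_apply] at h1 h2
  rw [choi_apply, cgMixture, LinearMap.add_apply, LinearMap.smul_apply, LinearMap.smul_apply,
    Matrix.add_apply, Matrix.smul_apply, Matrix.smul_apply, h1, h2]
  split_ifs <;> simp

lemma posSemidef_quadratic_nonneg {n : Type*} [Fintype n] {M : Matrix n n ℂ} (hM : M.PosSemidef)
    {e f : n} {x y z : ℝ} (hx : M e e = x) (hy : M f f = y) (hz : M e f = z) (s : ℝ) :
    0 ≤ x - 2 * s * z + s ^ 2 * y := by
  have hz' : M f e = z := by
    rw [← hM.isHermitian.apply, hz]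
    simp
  have h := (hM.submatrix ![e, f]).dotProduct_mulVec_nonneg ![1, -(s : ℂ)]
  have h' : star ![1, -(s : ℂ)] ⬝ᵥ (M.submatrix ![e, f] ![e, f]).mulVec ![1, -(s : ℂ)] =
      ((x - 2 * s * z + s ^ 2 * y : ℝ) : ℂ) := by
    simp [dotProduct, Matrix.mulVec, Fin.sum_univ_two, hx, hy, hz, hz']
    ring
  rw [h'] at h
  exact_mod_cast h

/-- The test vector `|01⟩ - √l |10⟩`, where `l = d + 1`, lies in the eigenspace of the partially
transposed Choi matrix whose eigenvalue changes sign at `p = 1 / (l + 1)`. -/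
lemma le_of_isPPT_cgMixture {d : ℕ} {p : ℝ} (h : IsPPT (cgMixture d p)) : 1 / ((d : ℝ) + 2) ≤ p := by
  have hd : (0 : ℝ) ≤ d := Nat.cast_nonneg d
  have e1 : partialTranspose (choi (cgMixture d p)) (0, 1) (0, 1) =
      (((1 - p) * cgAmplitudeSwap d 0 1 ^ 2 + p * cgAmplitude (d + 1) 0 1 ^ 2 : ℝ) : ℂ) := by
    simp [partialTranspose, choi_cgMixture]
    ring
  have e2 : partialTranspose (choi (cgMixture d p)) (1, 0) (1, 0) =
      (((1 - p) * cgAmplitudeSwap d 1 0 ^ 2 + p * cgAmplitude (d + 1) 1 0 ^ 2 : ℝ) : ℂ) := by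
    simp [partialTranspose, choi_cgMixture]
    ring
  have e3 : partialTranspose (choi (cgMixture d p)) (0, 1) (1, 0) =
      (((1 - p) * (cgAmplitudeSwap d 0 0 * cgAmplitudeSwap d 1 1) -
        p * (cgAmplitude (d + 1) 0 0 * cgAmplitude (d + 1) 1 1) : ℝ) : ℂ) := by
    simp [partialTranspose, choi_cgMixture]
    ring
  have key := posSemidef_quadratic_nonneg h e1 e2 e3 √(d + 1)
  have m1 : cgAmplitudeSwap d 0 0 * cgAmplitudeSwap d 1 1 =
      √(d + 1) * (2 / ((d + 1) * (d + 2))) := by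
    rw [cgAmplitudeSwap, cgAmplitudeSwap, ← Real.sqrt_mul (by simp; positivity),
      ← Real.sqrt_sq (show (0 : ℝ) ≤ 2 / ((d + 1) * (d + 2)) by positivity),
      ← Real.sqrt_mul (by positivity)]
    congr 1
    simp
    field_simp
  have m2 : cgAmplitude (d + 1) 0 0 * cgAmplitude (d + 1) 1 1 =
      √(d + 1) * (2 / ((d + 2) * (d + 3))) := by
    rw [cgAmplitude, cgAmplitude, ← Real.sqrt_mul (by simp; positivity),
      ← Real.sqrt_sq (show (0 : ℝ) ≤ 2 / ((d + 2) * (d + 3)) by positivity),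
      ← Real.sqrt_mul (by positivity)]
    congr 1
    simp
    field_simp
    ring
  have hs : √((d : ℝ) + 1) ^ 2 = d + 1 := Real.sq_sqrt (by positivity)
  rw [m1, m2, cgAmplitudeSwap_sq (by omega), cgAmplitudeSwap_sq (by omega),
    cgAmplitude_sq (by omega), cgAmplitude_sq (by omega), hs] at key
  have key2 : 0 ≤ (2 / ((d + 1) * (d + 2) : ℝ)) * ((d + 2) * ((d + 2) * p - 1)) := by
    refine key.trans (le_of_eq ?_)
    have : ∀ A B : ℝ, 2 * √(d + 1) * ((1 - p) * (√(d + 1) * A) - p * (√(d + 1) * B)) =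
        2 * (d + 1) * ((1 - p) * A - p * B) := by
      intro A B
      linear_combination 2 * ((1 - p) * A - p * B) * hs
    rw [this]
    push_cast
    field_simp
    ring
  have key3 := nonneg_of_mul_nonneg_right key2 (by positivity)
  have key4 := nonneg_of_mul_nonneg_right key3 (by positivity)
  rw [div_le_iff₀ (by positivity)]
  linarith

lemma IsEBT.isPPT {k l : ℕ} {Φ : Op k →ₗ[ℂ] Op l} (h : IsEBT Φ) : IsPPT Φ := by
  obtain ⟨n, w, ρ, σ, hw, -, hρ, hσ, hM⟩ := h
  have hk : (k : ℂ) + 1 ≠ 0 := Nat.cast_add_one_ne_zero k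
  have h1 : choi Φ = ((k : ℝ) + 1) • ∑ i, (w i) • (ρ i ⊗ₖ σ i) := by
    have : choi Φ = ((k : ℂ) + 1) • ((1 / ((k : ℂ) + 1)) • choi Φ) := by
      rw [smul_smul, mul_one_div_cancel hk, one_smul]
    rw [this, hM]
    ext s t
    simp [Matrix.sum_apply]
  have h2 : partialTranspose (choi Φ) =
      ((k : ℝ) + 1) • ∑ i, (w i) • (ρ i ⊗ₖ (σ i).transpose) := by
    rw [h1]
    ext s t
    simp [partialTranspose, Matrix.sum_apply]
  rw [IsPPT, h2]
  refine Matrix.PosSemidef.smul (Matrix.posSemidef_sum _ fun i _ => ?_) (by positivity)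
  exact ((hρ i).1.kronecker (hσ i).1.transpose).smul (hw i)

end SU2Channel

/-! ### Separability of averages of coherent product states -/

/-- In finite dimension, the convex hull of a compact set is compact: by Carathéodory's theorem it
is a continuous image of the product of a simplex with finitely many copies of the set. -/
lemma IsCompact.convexHull_of_finiteDimensional {E : Type*} [NormedAddCommGroup E]
    [NormedSpace ℝ E] [FiniteDimensional ℝ E] {s : Set E} (hs : IsCompact s) :
    IsCompact (convexHull ℝ s) := by
  rcases s.eq_empty_or_nonempty with rfl | ⟨z₀, hz₀⟩
  · simp
  set N := Module.finrank ℝ E + 1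
  have hc : IsCompact ((stdSimplex ℝ (Fin N)) ×ˢ (Set.univ.pi fun _ : Fin N => s)) :=
    (isCompact_stdSimplex ℝ (Fin N)).prod (isCompact_univ_pi fun _ => hs)
  have hf : Continuous fun q : (Fin N → ℝ) × (Fin N → E) => ∑ i, q.1 i • q.2 i := by fun_prop
  convert hc.image hf
  refine Set.Subset.antisymm (fun x hx => ?_) ?_
  · obtain ⟨ι, _, z, w, hz, hzi, hw, hw1, rfl⟩ := eq_pos_convex_span_of_mem_convexHull hx
    obtain ⟨e⟩ : Nonempty (ι ↪ Fin N) := Function.Embedding.nonempty_of_card_le (by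
      rw [Fintype.card_fin]
      exact hzi.card_le_finrank_succ.trans
        (Nat.succ_le_succ (Submodule.finrank_le _)))
    have hext : ∀ j, j ∉ Set.range e → Function.extend e w 0 j = 0 := fun j hj =>
      Function.extend_apply' _ _ _ (by simpa using hj)
    refine ⟨(Function.extend e w 0, Function.extend e z fun _ => z₀), ⟨⟨fun j => ?_, ?_⟩, ?_⟩, ?_⟩
    · by_cases hj : j ∈ Set.range e
      · obtain ⟨i, rfl⟩ := hj
        simpa [e.injective.extend_apply] using (hw i).le
      · simp [hext j hj]
    · rw [← hw1]
      exact (Fintype.sum_of_injective e e.injective _ _ hext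
        fun i => (e.injective.extend_apply w 0 i).symm).symm
    · intro j _
      by_cases hj : j ∈ Set.range e
      · obtain ⟨i, rfl⟩ := hj
        simpa [e.injective.extend_apply] using hz ⟨i, rfl⟩
      · simpa [Function.extend_apply' z _ j (by simpa using hj)] using hz₀
    · refine (Fintype.sum_of_injective e e.injective _ _ (fun j hj => ?_) fun i => ?_).symm
      · simp [hext j hj]
      · simp [e.injective.extend_apply]
  · rintro _ ⟨⟨w, z⟩, ⟨⟨hw, hw1⟩, hz⟩, rfl⟩
    exact (convex_convexHull ℝ s).sum_mem (fun i _ => hw i) hw1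
      fun i _ => subset_convexHull ℝ s (hz i trivial)

/-- Euler's beta integral at positive integers. -/
lemma integral_pow_mul_one_sub_pow (k m : ℕ) :
    ∫ s in (0 : ℝ)..1, s ^ k * (1 - s) ^ m = 1 / ((k + m + 1) * (k + m).choose k) := by
  induction m generalizing k with
  | zero => simp
  | succ m ih =>
    have hd : ∀ s : ℝ, HasDerivAt (fun s : ℝ => s ^ (k + 1) * (1 - s) ^ (m + 1))
        ((k + 1) * (s ^ k * (1 - s) ^ (m + 1)) - (m + 1) * (s ^ (k + 1) * (1 - s) ^ m)) s := by
      intro s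
      have h := (hasDerivAt_pow (k + 1) s).mul (((hasDerivAt_id s).const_sub 1).pow (m + 1))
      refine h.congr_deriv ?_
      simp
      ring
    have h := intervalIntegral.integral_eq_sub_of_hasDerivAt (a := 0) (b := 1) (fun s _ => hd s)
      (Continuous.intervalIntegrable (by fun_prop) _ _)
    rw [intervalIntegral.integral_sub (Continuous.intervalIntegrable (by fun_prop) _ _)
      (Continuous.intervalIntegrable (by fun_prop) _ _), intervalIntegral.integral_const_mul,
      intervalIntegral.integral_const_mul, ih] at h
    have hch : (k + 1 + m).choose (k + 1) * (k + 1) = (k + (m + 1)).choose k * (m + 1) := by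
      have := Nat.choose_succ_right_eq (k + (m + 1)) k
      rw [show k + (m + 1) - k = m + 1 by omega] at this
      rwa [show k + 1 + m = k + (m + 1) by omega]
    have h1 : (0 : ℝ) < (k + 1 + m).choose (k + 1) := Nat.cast_pos.2 (Nat.choose_pos (by omega))
    have h2 : (0 : ℝ) < (k + (m + 1)).choose k := Nat.cast_pos.2 (Nat.choose_pos (by omega))
    have h3 : (k + 1 : ℝ) * ∫ s in (0 : ℝ)..1, s ^ k * (1 - s) ^ (m + 1) =
        (m + 1) * (1 / (((k + 1 : ℕ) + m + 1) * (k + 1 + m).choose (k + 1))) := by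
      refine sub_eq_zero.1 (h.trans ?_)
      simp
    have h4 : (k + 1 : ℝ) ≠ 0 := by positivity
    refine mul_left_cancel₀ h4 (h3.trans ?_)
    rify at hch
    push_cast
    field_simp
    linear_combination (-(k + (m + 1) + 1 : ℝ)) * hch

namespace SU2Channel

lemma isState_vecMulVec {n : Type*} [Fintype n] (v : n → ℂ) (hv : v ⬝ᵥ star v = 1) :
    IsState (Matrix.vecMulVec v (star v)) :=
  ⟨Matrix.posSemidef_vecMulVec_self_star v, by rw [Matrix.trace_vecMulVec, hv]⟩

lemma isSeparable_of_iff_mem_convexHull {A B : Type*} [Fintype A] [Fintype B]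
    (M : A × B → A × B → ℂ) :
    IsSeparable (Matrix.of M) ↔ M ∈ convexHull ℝ
      {M | ∃ (ρ : Matrix A A ℂ) (σ : Matrix B B ℂ), IsState ρ ∧ IsState σ ∧
        M = fun p q => (ρ ⊗ₖ σ) p q} := by
  rw [mem_convexHull_iff_exists_fintype]
  constructor
  · rintro ⟨n, w, ρ, σ, hw, hw1, hρ, hσ, hM⟩
    refine ⟨Fin n, inferInstance, w, fun i p q => (ρ i ⊗ₖ σ i) p q, hw, hw1,
      fun i => ⟨ρ i, σ i, hρ i, hσ i, rfl⟩, ?_⟩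
    ext p q
    have := congrFun (congrFun hM p) q
    simp only [Matrix.of_apply, Matrix.sum_apply, Matrix.smul_apply, smul_eq_mul] at this
    simp [this]
  · rintro ⟨ι, _, w, z, hw, hw1, hz, rfl⟩
    choose ρ σ hρ hσ hz using hz
    let e := (Fintype.equivFin ι).symm
    refine ⟨Fintype.card ι, w ∘ e, ρ ∘ e, σ ∘ e, fun i => hw _, ?_, fun i => hρ _, fun i => hσ _, ?_⟩
    · rw [← hw1]
      exact e.sum_comp w
    · ext p q
      simp only [Matrix.of_apply, Finset.sum_apply, Pi.smul_apply, Matrix.sum_apply,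
        Matrix.smul_apply, Function.comp, hz, Complex.real_smul, smul_eq_mul]
      exact (e.sum_comp fun i => (w i : ℂ) * (ρ i ⊗ₖ σ i) p q).symm

/-- The coherent vector of `H_l` in the direction `(s, z)`: the `l`-th symmetric power of the qubit
vector `√(1-s) |0⟩ + √s z |1⟩`, where `0 ≤ s ≤ 1` and `|z| = 1`. -/
noncomputable def coherentVector (l : ℕ) (s : ℝ) (z : ℂ) (i : Fin (l + 1)) : ℂ :=
  (√(l.choose i) : ℂ) * (√(1 - s) : ℂ) ^ (l - (i : ℕ)) * ((√s : ℂ) * z) ^ (i : ℕ)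

lemma coherentVector_dotProduct_star (l : ℕ) {s : ℝ} (h0 : 0 ≤ s) (h1 : s ≤ 1) {z : ℂ}
    (hz : z * star z = 1) : coherentVector l s z ⬝ᵥ star (coherentVector l s z) = 1 := by
  have ht : ∀ i : Fin (l + 1), coherentVector l s z i * star (coherentVector l s z i) =
      ((s ^ (i : ℕ) * (1 - s) ^ (l - (i : ℕ)) * l.choose i : ℝ) : ℂ) := by
    intro i
    have e1 : (√(l.choose i) : ℂ) * √(l.choose i) = l.choose i := by
      rw [← Complex.ofReal_mul, Real.mul_self_sqrt (Nat.cast_nonneg _)]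
      simp
    have e2 : (√(1 - s) : ℂ) * √(1 - s) = ((1 - s : ℝ) : ℂ) := by
      rw [← Complex.ofReal_mul, Real.mul_self_sqrt (by linarith)]
    have e3 : (√s : ℂ) * √s = (s : ℂ) := by
      rw [← Complex.ofReal_mul, Real.mul_self_sqrt h0]
    simp only [coherentVector, star_mul', star_pow, RCLike.star_def, Complex.conj_ofReal]
    rw [RCLike.star_def] at hz
    calc _ = ((√(l.choose i) : ℂ) * √(l.choose i)) *
          ((√(1 - s) : ℂ) * √(1 - s)) ^ (l - (i : ℕ)) * ((√s : ℂ) * √s) ^ (i : ℕ) *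
          (z * (starRingEnd ℂ) z) ^ (i : ℕ) := by
          simp only [mul_pow]
          ring
      _ = _ := by
          rw [e1, e2, e3, hz]
          push_cast
          ring
  rw [dotProduct]
  simp only [Pi.star_apply, ht]
  rw [← Complex.ofReal_sum,
    Fin.sum_univ_eq_sum_range (fun i => s ^ i * (1 - s) ^ (l - i) * (l.choose i : ℝ)), ← add_pow]
  simp

/-- The product of the complex conjugate of a qubit coherent state with the corresponding coherent
state of `H_l`. -/
noncomputable def coherentProduct (l : ℕ) (s : ℝ) (z : ℂ) :
    Matrix (Fin (1 + 1) × Fin (l + 1)) (Fin (1 + 1) × Fin (l + 1)) ℂ :=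
  (Matrix.vecMulVec (coherentVector 1 s z) (star (coherentVector 1 s z))).transpose ⊗ₖ
    Matrix.vecMulVec (coherentVector l s z) (star (coherentVector l s z))

lemma coherentProduct_apply (l : ℕ) (s : ℝ) (z : ℂ)
    (a b : Fin (1 + 1)) (i j : Fin (l + 1)) :
    coherentProduct l s z (a, i) (b, j) = ((√(l.choose i) * √(l.choose j) *
      (√s ^ ((a : ℕ) + b + i + j) *
        √(1 - s) ^ ((1 - (a : ℕ)) + (1 - b) + (l - i) + (l - j))) : ℝ) : ℂ) *
      (z ^ ((b : ℕ) + i) * star z ^ ((a : ℕ) + j)) := by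
  have hc : ∀ c : Fin (1 + 1), (√((Nat.choose 1 c : ℕ) : ℝ) : ℂ) = 1 := by
    intro c
    fin_cases c <;> simp
  simp only [coherentProduct, Matrix.kroneckerMap_apply, Matrix.transpose_apply,
    Matrix.vecMulVec_apply, Pi.star_apply, coherentVector, hc, star_mul', star_pow,
    RCLike.star_def, Complex.conj_ofReal, map_one]
  push_cast
  simp only [mul_pow]
  ring

lemma continuous_coherentProduct (l : ℕ) :
    Continuous fun (q : ℝ × ℂ) p r => coherentProduct l q.1 q.2 p r := by
  refine continuous_pi fun p => continuous_pi fun r => ?_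
  simp only [coherentProduct, Matrix.kroneckerMap_apply, Matrix.transpose_apply,
    Matrix.vecMulVec_apply, Pi.star_apply, coherentVector]
  fun_prop

lemma sum_rootsOfUnity {N m n : ℕ} (hm : m < N) (hn : n < N) {ζ : ℂ} (hζ : IsPrimitiveRoot ζ N)
    (h1 : ζ * star ζ = 1) :
    ∑ k ∈ Finset.range N, (ζ ^ k) ^ m * star (ζ ^ k) ^ n = if n = m then (N : ℂ) else 0 := by
  have e : ∀ k, (ζ ^ k) ^ m * star (ζ ^ k) ^ n = (ζ ^ m * star ζ ^ n) ^ k := by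
    intro k
    rw [star_pow, mul_pow, ← pow_mul, ← pow_mul, ← pow_mul, ← pow_mul, mul_comm k, mul_comm k]
  simp only [e]
  split_ifs with h
  · subst h
    simp only [← mul_pow, h1, one_pow]
    simp
  · have hN : (ζ ^ m * star ζ ^ n) ^ N = 1 := by
      rw [mul_pow, ← pow_mul, ← pow_mul, mul_comm m, mul_comm n, pow_mul, pow_mul, ← star_pow,
        hζ.pow_eq_one]
      simp
    have hne : ζ ^ m * star ζ ^ n ≠ 1 := by
      intro h2
      refine h (hζ.pow_inj hn hm ?_)
      calc ζ ^ n = (ζ ^ m * star ζ ^ n) * ζ ^ n := by rw [h2, one_mul]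
        _ = ζ ^ m * (ζ * star ζ) ^ n := by rw [mul_pow]; ring
        _ = ζ ^ m := by rw [h1, one_pow, mul_one]
    have h3 := mul_neg_geom_sum (ζ ^ m * star ζ ^ n) N
    rw [hN, sub_self] at h3
    exact (mul_eq_zero.1 h3).resolve_left (sub_ne_zero.2 hne.symm)

/-- The average over the sphere of the states `coherentProduct`, written out: averaging over the
phase `z` leaves the entries with `i - a = j - b`, and averaging over `s` gives a beta integral. -/
noncomputable def coherentAverage (l : ℕ) :
    Matrix (Fin (1 + 1) × Fin (l + 1)) (Fin (1 + 1) × Fin (l + 1)) ℂ :=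
  Matrix.of fun p q => if (p.1 : ℕ) + q.2 = q.1 + p.2 then
    ((√(l.choose p.2) * √(l.choose q.2) / ((l + 2) * (l + 1).choose (p.1 + q.2)) : ℝ) : ℂ) else 0

/-- The average over the phase is a finite average over roots of unity; the average over
`s ∈ [0, 1]` stays in the convex hull of the compact set of the product states in question. -/
lemma isSeparable_coherentAverage (l : ℕ) : IsSeparable (coherentAverage l) := by
  set K : Set (Fin (1 + 1) × Fin (l + 1) → Fin (1 + 1) × Fin (l + 1) → ℂ) :=
    (fun (q : ℝ × ℂ) p r => coherentProduct l q.1 q.2 p r) ''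
      (Set.Icc 0 1 ×ˢ Metric.sphere 0 1) with hK
  have hunit : ∀ z : ℂ, z ∈ Metric.sphere (0 : ℂ) 1 → z * star z = 1 := by
    intro z hz
    rw [mem_sphere_zero_iff_norm] at hz
    rw [RCLike.star_def, Complex.mul_conj, Complex.normSq_eq_norm_sq, hz]
    simp
  have hKsub : K ⊆ {M | ∃ (ρ : Matrix (Fin (1 + 1)) (Fin (1 + 1)) ℂ)
      (σ : Matrix (Fin (l + 1)) (Fin (l + 1)) ℂ), IsState ρ ∧ IsState σ ∧
        M = fun p q => (ρ ⊗ₖ σ) p q} := by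
    rintro _ ⟨⟨s, z⟩, ⟨⟨h0, h1⟩, hz⟩, rfl⟩
    have hρ := isState_vecMulVec _ (coherentVector_dotProduct_star 1 h0 h1 (hunit z hz))
    exact ⟨_, _, ⟨hρ.1.transpose, by rw [Matrix.trace_transpose, hρ.2]⟩,
      isState_vecMulVec _ (coherentVector_dotProduct_star l h0 h1 (hunit z hz)), rfl⟩
  have hKc : IsCompact (convexHull ℝ K) :=
    ((isCompact_Icc.prod (isCompact_sphere 0 1)).image
      (continuous_coherentProduct l)).convexHull_of_finiteDimensional
  rw [coherentAverage, isSeparable_of_iff_mem_convexHull]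
  refine convexHull_mono hKsub ?_
  -- The exponents `i + b` and `j + a` of `z` and its conjugate are at most `l + 1`, so that roots of
  -- unity of order `l + 2` tell them apart.
  obtain ⟨ζ, hζ⟩ : ∃ ζ : ℂ, IsPrimitiveRoot ζ (l + 2) := ⟨_, Complex.isPrimitiveRoot_exp _ (by omega)⟩
  have hζs : ∀ k : ℕ, ζ ^ k ∈ Metric.sphere (0 : ℂ) 1 := by
    intro k
    rw [mem_sphere_zero_iff_norm, norm_pow, hζ.norm'_eq_one (by omega), one_pow]
  let F : ℝ → Fin (1 + 1) × Fin (l + 1) → Fin (1 + 1) × Fin (l + 1) → ℂ := fun s =>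
    ∑ k ∈ Finset.range (l + 2), (1 / (l + 2) : ℝ) • fun p r => coherentProduct l s (ζ ^ k) p r
  have hFc : Continuous F := continuous_finsetSum _ fun k _ =>
    ((continuous_coherentProduct l).comp
      (by fun_prop : Continuous fun s : ℝ => (s, ζ ^ k))).fun_const_smul _
  have hFmem : ∀ s ∈ Set.Icc (0 : ℝ) 1, F s ∈ convexHull ℝ K := fun s hs =>
    (convex_convexHull ℝ K).sum_mem (fun _ _ => by positivity)
      (by simp; field_simp) fun k _ => subset_convexHull ℝ K ⟨(s, ζ ^ k), ⟨hs, hζs k⟩, rfl⟩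
  have hFapply : ∀ s ∈ Set.Icc (0 : ℝ) 1, ∀ p q, F s p q =
      if (p.1 : ℕ) + q.2 = q.1 + p.2 then ((√(l.choose p.2) * √(l.choose q.2) *
        (s ^ ((p.1 : ℕ) + q.2) * (1 - s) ^ (l + 1 - ((p.1 : ℕ) + q.2))) : ℝ) : ℂ) else 0 := by
    rintro s ⟨h0, h1⟩ ⟨a, i⟩ ⟨b, j⟩
    have ha := a.2
    have hb := b.2
    have hi := i.2
    have hj := j.2
    simp only [F, Finset.sum_apply, Pi.smul_apply, coherentProduct_apply, Complex.real_smul,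
      ← mul_assoc]
    simp only [mul_assoc _ ((ζ ^ _) ^ _), ← Finset.mul_sum]
    rw [sum_rootsOfUnity (N := l + 2) (by omega) (by omega) hζ (by simpa using hunit _ (hζs 1))]
    split_ifs with h
    · rw [show (a : ℕ) + b + i + j = 2 * (a + j) by omega,
        show (1 - (a : ℕ)) + (1 - b) + (l - i) + (l - j) = 2 * (l + 1 - (a + j)) by omega,
        pow_mul, pow_mul, Real.sq_sqrt h0, Real.sq_sqrt (by linarith)]
      have : (l : ℂ) + 2 ≠ 0 := by exact_mod_cast (by omega : l + 2 ≠ 0)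
      push_cast
      field_simp
    · rw [mul_zero]
  have : MeasureTheory.IsProbabilityMeasure
    (MeasureTheory.volume.restrict (Set.Ioc (0 : ℝ) 1)) := ⟨by simp⟩
  have hFint : MeasureTheory.IntegrableOn F (Set.Ioc 0 1) :=
    hFc.integrableOn_Icc.mono_set Set.Ioc_subset_Icc_self
  have hint := (convex_convexHull ℝ K).integral_mem (μ := MeasureTheory.volume.restrict
    (Set.Ioc (0 : ℝ) 1)) hKc.isClosed (f := F) ?_ hFint
  · convert hint using 1
    ext p q
    have hp := p.1.2
    have hq := q.2.2
    have hentry := ((ContinuousLinearMap.proj (R := ℝ) (φ := fun _ => ℂ) q).comp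
      (ContinuousLinearMap.proj (R := ℝ) (φ := fun _ => _ → ℂ) p)).integral_comp_comm hFint
    simp only [ContinuousLinearMap.comp_apply, ContinuousLinearMap.proj_apply] at hentry
    rw [← hentry, MeasureTheory.setIntegral_congr_fun measurableSet_Ioc
      fun s hs => hFapply s ⟨hs.1.le, hs.2⟩ p q]
    split_ifs with h
    · rw [integral_complex_ofReal, MeasureTheory.integral_const_mul,
        ← intervalIntegral.integral_of_le zero_le_one, integral_pow_mul_one_sub_pow,
        show (p.1 : ℕ) + q.2 + (l + 1 - (p.1 + q.2)) = l + 1 by omega]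
      have : (((p.1 : ℕ) + (q.2 : ℕ) : ℕ) : ℝ) + ((l + 1 - ((p.1 : ℕ) + q.2) : ℕ) : ℝ) + 1 = l + 2 := by
        rw [Nat.cast_sub (by omega)]
        push_cast
        ring
      rw [this]
      ring_nf
    · simp
  · exact (MeasureTheory.ae_restrict_mem measurableSet_Ioc).mono
      fun s hs => hFmem s ⟨hs.1.le, hs.2⟩

end SU2Channel

/-! ### Entanglement breaking mixtures -/

namespace SU2Channel

/-- The image of a separable state under `X ↦ σ_y Xᵀ σ_y`, the spin flip, on the first qubit. This
is a positive, although not completely positive, map. -/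
lemma IsSeparable.spinFlip {B : Type*} [Fintype B]
    {M : Matrix (Fin (1 + 1) × B) (Fin (1 + 1) × B) ℂ} (h : IsSeparable M) :
    IsSeparable (Matrix.of fun p q : Fin (1 + 1) × B =>
      (-1 : ℂ) ^ ((p.1 : ℕ) + q.1) * M (q.1.rev, p.2) (p.1.rev, q.2)) := by
  obtain ⟨n, w, ρ, σ, hw, hw1, hρ, hσ, rfl⟩ := h
  refine ⟨n, w, fun i => Matrix.of fun a b => (-1 : ℂ) ^ ((a : ℕ) + b) * ρ i b.rev a.rev, σ, hw, hw1,
    fun i => ⟨?_, ?_⟩, hσ, ?_⟩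
  · have e : (Matrix.of fun a b : Fin (1 + 1) => (-1 : ℂ) ^ ((a : ℕ) + b) * ρ i b.rev a.rev) =
        Matrix.diagonal (fun a : Fin (1 + 1) => (-1 : ℂ) ^ (a : ℕ)) *
          (ρ i).transpose.submatrix Fin.rev Fin.rev *
          (Matrix.diagonal fun a : Fin (1 + 1) => (-1 : ℂ) ^ (a : ℕ)).conjTranspose := by
      ext a b
      simp [Matrix.diagonal_conjTranspose, Matrix.mul_diagonal, Matrix.diagonal_mul, pow_add]
      ring
    change (Matrix.of _).PosSemidef
    rw [e]
    exact ((hρ i).1.transpose.submatrix Fin.rev).mul_mul_conjTranspose_same _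
  · refine Eq.trans ?_ (hρ i).2
    simp only [Matrix.trace, Matrix.diag, Matrix.of_apply, ← two_mul, pow_mul]
    simpa using Equiv.sum_comp Fin.revPerm fun a => ρ i a a
  · ext p q
    simp only [Matrix.of_apply, Matrix.sum_apply, Matrix.smul_apply, Matrix.kroneckerMap_apply,
      smul_eq_mul, Finset.mul_sum]
    exact Finset.sum_congr rfl fun i _ => by ring

lemma sqrt_choose_div {l a b i j : ℕ} (ha : a ≤ 1) (hb : b ≤ 1) (hi : i ≤ l) (hj : j ≤ l)
    (h : a + j = b + i) :
    √(l.choose i) * √(l.choose j) / ((l + 2) * (l + 1).choose (a + j)) =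
      cgAmplitude l (1 - b) i * cgAmplitude l (1 - a) j / 2 := by
  have key : ∀ {b i : ℕ}, b ≤ 1 → i ≤ l → cgAmplitude l (1 - b) i =
      √(2 / (l + 2)) * √(l.choose i) / √((l + 1).choose (b + i)) := by
    intro b i hb hi
    rw [← Real.sqrt_mul (by positivity), ← Real.sqrt_div (by positivity), mul_div_assoc,
      cgAmplitude]
    congr 1
    interval_cases b
    · rw [zero_add, choose_div_choose_succ hi]
      simp
      field_simp
    · rw [add_comm 1 i, choose_div_choose_succ_succ hi]
      simp
      field_simp
  have h0 : (0 : ℝ) < (l + 1).choose (a + j) := Nat.cast_pos.2 (Nat.choose_pos (by omega))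
  rw [key hb hi, key ha hj, ← h]
  have e1 : √(2 / (l + 2 : ℝ)) ^ 2 = 2 / (l + 2) := Real.sq_sqrt (by positivity)
  have e2 : √((l + 1).choose (a + j) : ℝ) ^ 2 = (l + 1).choose (a + j) := Real.sq_sqrt h0.le
  calc _ = √(l.choose i) * √(l.choose j) * (2 / (l + 2)) / ((l + 1).choose (a + j)) / 2 := by
        field_simp
    _ = √(l.choose i) * √(l.choose j) * √(2 / (l + 2 : ℝ)) ^ 2 /
          √((l + 1).choose (a + j) : ℝ) ^ 2 / 2 := by rw [e1, e2]
    _ = _ := by ring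

lemma coherentAverage_apply (l : ℕ) (a b : Fin (1 + 1)) (i j : Fin (l + 1)) :
    coherentAverage l (a, i) (b, j) = if (a : ℕ) + j = b + i then
      ((cgAmplitude l (1 - b) i * cgAmplitude l (1 - a) j / 2 : ℝ) : ℂ) else 0 := by
  have ha := a.2
  have hb := b.2
  have hi := i.2
  have hj := j.2
  simp only [coherentAverage, Matrix.of_apply]
  split_ifs with h
  · rw [sqrt_choose_div (by omega) (by omega) (by omega) (by omega) h]
  · rfl

lemma cgAmplitudeSwap_mul_cgAmplitudeSwap {d i : ℕ} (hi : i ≤ d) :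
    cgAmplitudeSwap d 0 i * cgAmplitudeSwap d 1 (i + 1) =
      (d + 3) / (d + 1) * (cgAmplitude (d + 1) 0 i * cgAmplitude (d + 1) 1 (i + 1)) := by
  have h : (i : ℝ) ≤ d := by exact_mod_cast hi
  have h1 : (0 : ℝ) ≤ d + 1 - i := by linarith
  have hc : (0 : ℝ) ≤ (d + 3) / (d + 1) := by positivity
  simp only [cgAmplitudeSwap, cgAmplitude, if_true, one_ne_zero, if_false]
  rw [← Real.sqrt_mul (by positivity), ← Real.sqrt_mul (by positivity), ← Real.sqrt_sq hc,
    ← Real.sqrt_mul (by positivity)]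
  congr 1
  push_cast
  field_simp
  ring

/-- At `p = 1 / (l + 1)`, where `l = d + 1`, the channel measures a qubit against the coherent
states and prepares the corresponding coherent state of `H_l`. -/
lemma choi_cgMixture_left (d : ℕ) :
    (1 / 2 : ℂ) • choi (cgMixture d (1 / (d + 2))) = coherentAverage (d + 1) := by
  ext ⟨a, i⟩ ⟨b, j⟩
  rw [Matrix.smul_apply, choi_cgMixture, coherentAverage_apply]
  split_ifs with h
  · have hi := i.2
    have hj := j.2
    rw [smul_eq_mul, show (1 / 2 : ℂ) = ((1 / 2 : ℝ) : ℂ) by simp, ← Complex.ofReal_mul]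
    congr 1
    have hd : (0 : ℝ) < d + 1 := by positivity
    rcases a with ⟨_ | _ | a, ha⟩
    · rcases b with ⟨_ | _ | b, hb⟩
      · obtain rfl : i = j := Fin.ext (by simpa using h.symm)
        simp only [zero_add, pow_zero, one_mul, Nat.sub_zero, ← sq]
        rw [cgAmplitudeSwap_sq (by omega), cgAmplitude_sq (by omega), cgAmplitude_sq (by omega)]
        simp
        field_simp
        ring
      · have hj' : (j : ℕ) = i + 1 := by simp at h; omega
        simp only [hj', zero_add, Nat.sub_zero, Nat.sub_self]
        rw [cgAmplitudeSwap_mul_cgAmplitudeSwap (by omega)]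
        field_simp
        ring
      · omega
    · rcases b with ⟨_ | _ | b, hb⟩
      · have hi' : (i : ℕ) = j + 1 := by simp at h; omega
        simp only [hi', zero_add, add_zero, Nat.sub_zero, Nat.sub_self]
        rw [mul_comm (cgAmplitudeSwap d 1 _), cgAmplitudeSwap_mul_cgAmplitudeSwap (by omega)]
        field_simp
        ring
      · obtain rfl : i = j := Fin.ext (by simpa using h.symm)
        simp only [zero_add, Nat.sub_self, ← sq]
        rw [cgAmplitudeSwap_sq (by omega), cgAmplitude_sq (by omega), cgAmplitude_sq (by omega)]
        simp
        field_simp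
        ring
      · omega
    · omega
  · simp

/-- At `p = 1`, the channel measures a qubit against the coherent states and prepares the antipodal
coherent state. -/
lemma choi_cgMixture_one (d : ℕ) :
    (1 / 2 : ℂ) • choi (cgMixture d 1) =
      Matrix.of fun p q : Fin (1 + 1) × Fin (d + 1 + 1) =>
        (-1 : ℂ) ^ ((p.1 : ℕ) + q.1) * coherentAverage (d + 1) (q.1.rev, p.2) (p.1.rev, q.2) := by
  ext ⟨a, i⟩ ⟨b, j⟩
  have ha := a.2
  have hb := b.2
  rw [Matrix.smul_apply, choi_cgMixture, Matrix.of_apply, coherentAverage_apply]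
  have hiff : (b.rev : ℕ) + j = a.rev + i ↔ (a : ℕ) + j = b + i := by
    simp only [Fin.val_rev]
    omega
  simp only [hiff]
  split_ifs with h
  · rw [show 1 - (a.rev : ℕ) = a by simp only [Fin.val_rev]; omega,
      show 1 - (b.rev : ℕ) = b by simp only [Fin.val_rev]; omega]
    push_cast
    rw [smul_eq_mul]
    ring
  · simp

lemma isEBT_cgMixture {d : ℕ} {p : ℝ} (h0 : 1 / ((d : ℝ) + 2) ≤ p) (h1 : p ≤ 1) :
    IsEBT (cgMixture d p) := by
  have hsep := isSeparable_coherentAverage (d + 1)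
  have hflip := hsep.spinFlip
  rw [← choi_cgMixture_left] at hsep
  rw [← choi_cgMixture_one] at hflip
  have hd : (0 : ℝ) < d + 1 := by positivity
  set t : ℝ := ((d + 2) * p - 1) / (d + 1) with ht
  have ht0 : 0 ≤ t := by
    rw [div_le_iff₀ (by positivity)] at h0
    exact div_nonneg (by linarith) hd.le
  have ht1 : t ≤ 1 := by
    rw [ht, div_le_one hd]
    nlinarith
  have hconv := (convex_convexHull ℝ _)
    ((isSeparable_of_iff_mem_convexHull _).1 hsep) ((isSeparable_of_iff_mem_convexHull _).1 hflip)
    (sub_nonneg.2 ht1) ht0 (by ring)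
  have := (isSeparable_of_iff_mem_convexHull _).2 hconv
  rw [IsEBT]
  convert this using 1
  ext ⟨a, i⟩ ⟨b, j⟩
  have e : p = (1 - t) * (1 / (d + 2)) + t * 1 := by
    rw [ht]
    field_simp
    ring
  simp only [Matrix.of_apply, Pi.add_apply, Pi.smul_apply, Matrix.smul_apply, choi_cgMixture]
  split_ifs
  · rw [e]
    simp
    ring
  · simp

end SU2Channel

/-- The first two conjuncts say that the Clebsch-Gordan channels `Φ^{1→l}_{l-1}` and
`Φ^{1→l}_{l+1}` are well defined; the third one is the equivalence of PPT, `1/(l+1) ≤ p ≤ 1`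
and EBT for `Φ_p = (1 - p) Φ^{1→l}_{l-1} + p Φ^{1→l}_{l+1}`. -/
theorem theorem3p1 (l : ℕ) (hl : 1 ≤ l) :
    (∃! Φ, SU2Channel.IsClebschGordanChannel 1 l (l - 1) Φ) ∧
    (∃! Φ, SU2Channel.IsClebschGordanChannel 1 l (l + 1) Φ) ∧
    ∀ (Φ₀ Φ₁ : SU2Channel.Op 1 →ₗ[ℂ] SU2Channel.Op l),
      SU2Channel.IsClebschGordanChannel 1 l (l - 1) Φ₀ →
      SU2Channel.IsClebschGordanChannel 1 l (l + 1) Φ₁ →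
      ∀ p : ℝ, 0 ≤ p → p ≤ 1 →
        (SU2Channel.IsPPT (((1 - p : ℝ) : ℂ) • Φ₀ + (p : ℂ) • Φ₁) ↔
          1 / ((l : ℝ) + 1) ≤ p ∧ p ≤ 1) ∧
        ((1 / ((l : ℝ) + 1) ≤ p ∧ p ≤ 1) ↔
          SU2Channel.IsEBT (((1 - p : ℝ) : ℂ) • Φ₀ + (p : ℂ) • Φ₁)) := by
  obtain ⟨d, rfl⟩ : ∃ d, l = d + 1 := ⟨l - 1, by omega⟩
  rw [Nat.add_sub_cancel]
  refine ⟨⟨_, ⟨_, (SU2Channel.isClebschGordanIsometry_cgIsometry d).swap, rfl⟩,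
    fun _ h => h.eq_cgIsometry_swap⟩, ⟨_, ⟨_, SU2Channel.isClebschGordanIsometry_cgIsometry _, rfl⟩,
    fun _ h => h.eq_cgIsometry⟩, fun Φ₀ Φ₁ h₀ h₁ p _ hp1 => ?_⟩
  have hmix : ((1 - p : ℝ) : ℂ) • Φ₀ + (p : ℂ) • Φ₁ = SU2Channel.cgMixture d p := by
    rw [h₀.eq_cgIsometry_swap, h₁.eq_cgIsometry, SU2Channel.cgMixture]
  have hl : ((d + 1 : ℕ) : ℝ) + 1 = d + 2 := by
    push_cast
    ring
  rw [hmix, hl]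
  have hPPT : SU2Channel.IsPPT (SU2Channel.cgMixture d p) → 1 / ((d : ℝ) + 2) ≤ p ∧ p ≤ 1 :=
    fun h => ⟨SU2Channel.le_of_isPPT_cgMixture h, hp1⟩
  have hEBT : 1 / ((d : ℝ) + 2) ≤ p ∧ p ≤ 1 → SU2Channel.IsEBT (SU2Channel.cgMixture d p) :=
    fun h => SU2Channel.isEBT_cgMixture h.1 h.2
  exact ⟨⟨hPPT, fun h => (hEBT h).isPPT⟩, ⟨hEBT, fun h => hPPT h.isPPT⟩⟩
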